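/- **Recovery from an erroneous hub measurement.** Let $S$ and $H$ be disjoint finite sets of nodes ($H$ is the hub), let $m\ge 1$, and let $A$ be a random $m\times|S|$ matrix whose last row is all ones and whose other entries are independent and equal to $0$ or $1$ with probability $1/2$ each. For a signal $\mathbf x=(\mathbf x_S,\mathbf x_H)\in\mathbb R^{S}\times\mathbb R^{H}$, one observes the exact measurements $\mathbf z=A\mathbf x_S+(\mathbf 1^T\mathbf x_H)\mathbf 1_m$ and an erroneous hub measurement $\hat z_0=\mathbf 1^T\mathbf x_H+e_0$, where $e_0\in\mathbb R$ is unknown. Put $\mathbf y=\mathbf z-\hat z_0\mathbf 1_m$, let $\hat{\mathbf y}$ be its first $m-1$ entries and $y_m$ its last entry, and let $\mathbf x'=(\mathbf x_S,e_0)\in\mathbb R^{|S|+1}$ be the augmented vector. Let $\hat A$ be the first $m-1$ rows of $A'=[A\;\;-\mathbf 1_m]$, and let $W$ be the $(m-1)\times(|S|+1)$ matrix each of whose rows is $(1,\dots,1,-1)$ (the last row of $A'$). Consider the $\ell_1$ program $$\min_{\mathbf u\in\mathbb R^{|S|+1}}\|\mathbf u\|_1\quad\text{subject to}\quad(2\hat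 A-W)\mathbf u=2\hat{\mathbf y}-y_m\mathbf 1_{m-1}.\qquad(*)$$ Then there are absolute constants $C>0$, $\alpha>0$, $K>0$ and $n_0$ such that for all $S,H$ with $|S|\ge n_0$, all integers $k\ge 0$, and all $m\ge C(k+1)\log|S|$, with probability at least $1-K|S|^{-\alpha}$ over $A$ the following holds simultaneously for all $\mathbf x_S$ and $e_0$ such that $\mathbf x'=(\mathbf x_S,e_0)$ has at most $k+1$ nonzero entries, and for all $\mathbf x_H$: the vector $\mathbf x'$ is the unique solution of $(*)$. -/

import Mathlib

open MeasureTheory ProbabilityTheory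

namespace HubRecovery

/-- The random matrix `A` with `m = p + 1` rows and columns indexed by `S`: every entry of the last
row is `1`, and the entries of the first `p` rows are independent and take the values `1` and `0`
with probability `1/2` each. -/
structure IsRandomConstruction {Ω : Type*} [MeasurableSpace Ω] (μ : Measure Ω) {p : ℕ} {S : Type*}
    (A : Ω → Matrix (Fin (p + 1)) S ℝ) : Prop where
  measurable_entry : ∀ i j, Measurable fun ω => A ω i j
  last_row : ∀ ω j, A ω (Fin.last p) j = 1
  indep : iIndepFun (fun (ij : Fin p × S) ω => A ω ij.1.castSucc ij.2) μ
  prob_one : ∀ (i : Fin p) j, μ {ω | A ω i.castSucc j = 1} = 1 / 2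
  prob_zero : ∀ (i : Fin p) j, μ {ω | A ω i.castSucc j = 0} = 1 / 2

/-- The measurement matrix `F = [[A, W], [0ᵀ, 1ᵀ]]` for measuring `S` through the hub `H`, where
`W` has all entries `1`; the last row is the direct measurement of the hub. -/
def hubMatrix {m : ℕ} {S H : Type*} (A : Matrix (Fin m) S ℝ) :
    Matrix (Fin m ⊕ Unit) (S ⊕ H) ℝ :=
  Matrix.fromBlocks A (Matrix.of fun _ _ => (1 : ℝ)) 0 (Matrix.of fun _ _ => (1 : ℝ))

/-- The vector of actual measurements `(z, ẑ₀)` of the signal `(x_S, x_H)`: the measurement of the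
hub carries the error `e₀`, the others are exact. -/
def measurements {m : ℕ} {S H : Type*} [Fintype S] [Fintype H] (A : Matrix (Fin m) S ℝ)
    (xS : S → ℝ) (xH : H → ℝ) (e₀ : ℝ) : Fin m ⊕ Unit → ℝ :=
  (hubMatrix A).mulVec (Sum.elim xS xH) + Sum.elim (fun _ => 0) (fun _ => e₀)

/-- The vector `y = z - ẑ₀ 1`, computed from the actual measurements. -/
def correctedData {m : ℕ} (q : Fin m ⊕ Unit → ℝ) : Fin m → ℝ :=
  fun i => q (Sum.inl i) - q (Sum.inr ())

/-- The augmented vector `x' = (x_S, e₀)`. -/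
def augVector {S : Type*} (xS : S → ℝ) (e₀ : ℝ) : S ⊕ Unit → ℝ :=
  Sum.elim xS (fun _ => e₀)

/-- The augmented matrix `A' = [A, -1]`. -/
def augMatrix {m : ℕ} {S : Type*} (A : Matrix (Fin m) S ℝ) : Matrix (Fin m) (S ⊕ Unit) ℝ :=
  Matrix.fromCols A (Matrix.of fun _ _ => (-1 : ℝ))

/-- The constraint matrix `2 Â - W` of the modified program. Here `Â` consists of all rows of
`A' = [A, -1]` but the last, and every row of `W` is `(1, …, 1, -1)`, which is the last row of
`A'` when the last row of `A` is all ones. -/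
def programMatrix {p : ℕ} {S : Type*} (A : Matrix (Fin (p + 1)) S ℝ) :
    Matrix (Fin p) (S ⊕ Unit) ℝ :=
  (2 : ℝ) • (augMatrix A).submatrix Fin.castSucc id -
    Matrix.fromCols (Matrix.of fun _ _ => (1 : ℝ)) (Matrix.of fun _ _ => (-1 : ℝ))

/-- The right-hand side `2 ŷ - y_m 1` of the modified program, where `ŷ` consists of all entries
of `y` but the last, `y_m`. -/
def programData {p : ℕ} (y : Fin (p + 1) → ℝ) : Fin p → ℝ :=
  fun i => 2 * y i.castSucc - y (Fin.last p)

/-- `x` is at most `s`-sparse. -/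
def IsSparse {ι : Type*} (s : ℕ) (x : ι → ℝ) : Prop :=
  (Function.support x).ncard ≤ s

/-- `x` is the unique solution of `min ‖u‖₁` subject to `M u = b`. -/
def IsUniqueL1Solution {ι κ : Type*} [Fintype κ] (M : Matrix ι κ ℝ) (b : ι → ℝ) (x : κ → ℝ) :
    Prop :=
  M.mulVec x = b ∧ ∀ u : κ → ℝ, M.mulVec u = b → u ≠ x → ∑ j, |x j| < ∑ j, |u j|

end HubRecovery

/-!
The program matrix is `[R, -1]` with `R` a matrix of independent random signs, and the data of the
program are the exact image of the augmented vector (`programData_eq_mulVec`): the unknown signal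
on the hub cancels. It therefore suffices to prove the null space property of order `s = k + 1`:
no nonzero `v` with `M v = 0` has at least half of its `ℓ¹`-norm on `s` coordinates.

Such a `v`, normalized to `‖v‖₁ = 1`, has `‖v‖₂² ≥ 1 / (4 s)` by the Cauchy-Schwarz inequality. As a
convex combination of signed unit vectors it is approximated by Maurey's method
(`exists_norm_sum_sub_smul_sq_le`): for every `t` there is a sum `y` of `t` signed unit vectors with
`‖y - t v‖₂² + ‖M y‖₂² / p ≤ 2 t`. The second term is controlled along with the first because the
columns of `M` have squared norm exactly `p`. For `t = 72 s` this gives `‖y‖₂² ≥ 8 t` and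
`‖M y‖₂² ≤ 2 t p`, so that `‖M y‖₂² ≤ p ‖y‖₂² / 4`
(`sum_abs_lt_sum_abs_compl_of_mulVec_eq_zero`).

For a fixed `y ≠ 0` the latter has probability at most `exp (-p / 12)`
(`measureReal_sum_sq_le`): an affine form `Z` in random signs satisfies `E Z⁴ ≤ 3 (E Z²)²`, which
bounds `E exp (-l Z²)` through the second order expansion, and the rows are independent. There are
only `(2 (|S| + 1)) ^ (72 s)` candidates for `y`, so the union bound costs a factor
`exp (O(s log |S|))`, which `p ≥ C s log |S|` absorbs.
-/

namespace HubRecovery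

/-! ### Greedy sparse approximation of convex combinations -/

/-- One step of the approximation: since the mean of `a i - v` under the weights `w` vanishes, some
`a i - v` can be added to `x` at the cost of at most `r` in squared norm. -/
lemma exists_norm_add_sub_sq_le {E ι : Type*} [NormedAddCommGroup E] [InnerProductSpace ℝ E]
    [Fintype ι] {w : ι → ℝ} (hw : ∀ i, 0 ≤ w i) (hw1 : ∑ i, w i = 1) {a : ι → E} {r : ℝ}
    (ha : ∀ i, ‖a i‖ ^ 2 ≤ r) (x : E) :
    ∃ i, ‖x + (a i - ∑ j, w j • a j)‖ ^ 2 ≤ ‖x‖ ^ 2 + r := by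
  set v := ∑ j, w j • a j with hv
  by_contra! h
  have h1 : ∑ i, w i * ‖x + (a i - v)‖ ^ 2 ≤ ‖x‖ ^ 2 + r := by
    have e : ∀ i, w i * ‖x + (a i - v)‖ ^ 2 =
        w i * ‖x - v‖ ^ 2 + 2 * inner ℝ (x - v) (w i • a i) + w i * ‖a i‖ ^ 2 := by
      intro i
      rw [show x + (a i - v) = (x - v) + a i by abel, norm_add_sq_real, inner_smul_right]
      ring
    simp_rw [e]
    rw [Finset.sum_add_distrib, Finset.sum_add_distrib, ← Finset.sum_mul, ← Finset.mul_sum,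
      ← inner_sum, ← hv, hw1]
    have h2 : ∑ i, w i * ‖a i‖ ^ 2 ≤ r := by
      calc ∑ i, w i * ‖a i‖ ^ 2 ≤ ∑ i, w i * r :=
            Finset.sum_le_sum fun i _ => mul_le_mul_of_nonneg_left (ha i) (hw i)
        _ = r := by rw [← Finset.sum_mul, hw1, one_mul]
    rw [norm_sub_sq_real, inner_sub_left, real_inner_self_eq_norm_sq]
    nlinarith [sq_nonneg ‖v‖]
  have h0 : ∀ i, 0 ≤ w i * (‖x + (a i - v)‖ ^ 2 - (‖x‖ ^ 2 + r)) := fun i =>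
    mul_nonneg (hw i) (sub_nonneg.2 (h i).le)
  have hs : ∑ i, w i * (‖x + (a i - v)‖ ^ 2 - (‖x‖ ^ 2 + r)) = 0 := by
    refine le_antisymm ?_ (Finset.sum_nonneg fun i _ => h0 i)
    simp_rw [mul_sub]
    rw [Finset.sum_sub_distrib, ← Finset.sum_mul, hw1]
    linarith
  have hz : ∀ i, w i = 0 := fun i => by
    have := (Finset.sum_eq_zero_iff_of_nonneg fun i _ => h0 i).1 hs i (Finset.mem_univ i)
    exact (mul_eq_zero.1 this).resolve_right (sub_pos.2 (h i)).ne'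
  simp [hz] at hw1

/-- Maurey's empirical approximation: a convex combination of vectors of squared norm at most `r`
is approximated by the average of `t` of these vectors with squared error at most `r / t`. -/
lemma exists_norm_sum_sub_smul_sq_le {E ι : Type*} [NormedAddCommGroup E] [InnerProductSpace ℝ E]
    [Fintype ι] {w : ι → ℝ} (hw : ∀ i, 0 ≤ w i) (hw1 : ∑ i, w i = 1) {a : ι → E} {r : ℝ}
    (ha : ∀ i, ‖a i‖ ^ 2 ≤ r) (t : ℕ) :
    ∃ f : Fin t → ι, ‖∑ i, a (f i) - (t : ℝ) • ∑ j, w j • a j‖ ^ 2 ≤ t * r := by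
  induction t with
  | zero => exact ⟨Fin.elim0, by simp⟩
  | succ t ih =>
    obtain ⟨f, hf⟩ := ih
    obtain ⟨i, hi⟩ := exists_norm_add_sub_sq_le hw hw1 ha
      (∑ i, a (f i) - (t : ℝ) • ∑ j, w j • a j)
    refine ⟨Fin.snoc f i, ?_⟩
    rw [Fin.sum_univ_castSucc]
    simp only [Fin.snoc_castSucc, Fin.snoc_last]
    have e : ∑ k, a (f k) + a i - ((t + 1 : ℕ) : ℝ) • ∑ j, w j • a j =
        (∑ k, a (f k) - (t : ℝ) • ∑ j, w j • a j) + (a i - ∑ j, w j • a j) := by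
      push_cast
      rw [add_smul, one_smul]
      abel
    rw [e]
    push_cast
    linarith

/-- The sum of a finite sequence of signed unit vectors; the pair `(j, true)` encodes the unit
vector `e_j` and `(j, false)` encodes `-e_j`. -/
noncomputable def signedSum {κ : Type*} [DecidableEq κ] {t : ℕ} (f : Fin t → κ × Bool) : κ → ℝ :=
  ∑ i, Pi.single (f i).1 (if (f i).2 then 1 else -1)

/-- A kernel vector `v` of `ℓ¹`-norm one is approximated by signed unit vectors, simultaneously in
`ℓ²` and in the seminorm induced by `M`. -/
lemma exists_signedSum_approx {κ : Type*} [Fintype κ] [DecidableEq κ] {p : ℕ} (hp : 0 < p)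
    {M : Matrix (Fin p) κ ℝ} (hM : ∀ i j, M i j ^ 2 = 1) {v : κ → ℝ} (hv : M.mulVec v = 0)
    (hv1 : ∑ j, |v j| = 1) (t : ℕ) :
    ∃ f : Fin t → κ × Bool, ∑ j, (signedSum f j - t * v j) ^ 2 +
      (p : ℝ)⁻¹ * ∑ i, (M.mulVec (signedSum f)) i ^ 2 ≤ t * 2 := by
  -- The map `x ↦ (x, p^{-1/2} M x)` turns the sum of the two squared seminorms into one norm.
  let φ : (κ → ℝ) →ₗ[ℝ] EuclideanSpace ℝ (κ ⊕ Fin p) :=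
    (WithLp.linearEquiv 2 ℝ (κ ⊕ Fin p → ℝ)).symm.toLinearMap ∘ₗ
      (Matrix.fromRows (1 : Matrix κ κ ℝ) ((Real.sqrt p)⁻¹ • M)).mulVecLin
  have hφ : ∀ x, ‖φ x‖ ^ 2 = ∑ j, x j ^ 2 + (p : ℝ)⁻¹ * ∑ i, (M.mulVec x) i ^ 2 := by
    intro x
    rw [EuclideanSpace.real_norm_sq_eq]
    simp [φ, Fintype.sum_sum_type, Matrix.fromRows_mulVec, Matrix.smul_mulVec, mul_pow,
      Finset.mul_sum]
  let σ : κ → κ × Bool := fun j => (j, decide (0 ≤ v j))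
  let e : κ × Bool → (κ → ℝ) := fun q => Pi.single q.1 (if q.2 then 1 else -1)
  have hcol : ∀ q, ‖φ (e q)‖ ^ 2 ≤ 2 := by
    rintro ⟨j, b⟩
    have hb : (if b then (1 : ℝ) else -1) ^ 2 = 1 := by cases b <;> simp
    rw [hφ]
    have h1 : ∑ k, e (j, b) k ^ 2 = 1 := by
      simp [e, Pi.single_apply, ite_pow, hb]
    have h2 : ∀ i, (M.mulVec (e (j, b))) i ^ 2 = 1 := by
      intro i
      simp only [e, Matrix.mulVec_single, Pi.smul_apply, Matrix.col_apply,
        MulOpposite.smul_eq_mul_unop, MulOpposite.unop_op, mul_pow, hb, hM, mul_one]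
    have hp' : (p : ℝ) ≠ 0 := by positivity
    simp [h1, h2, hp']
    norm_num
  have hcomb : ∑ j, |v j| • e (σ j) = v := by
    ext k
    rw [Finset.sum_apply, Finset.sum_eq_single k]
    · by_cases h : 0 ≤ v k
      · simp [e, σ, h, abs_of_nonneg]
      · simp [e, σ, h, abs_of_neg (not_le.1 h)]
    · intro j _ hjk
      simp [e, σ, hjk.symm]
    · simp
  obtain ⟨f, hf⟩ := exists_norm_sum_sub_smul_sq_le (fun j => abs_nonneg (v j)) hv1
    (a := fun j => φ (e (σ j))) (fun j => hcol _) t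
  refine ⟨fun i => σ (f i), ?_⟩
  have h1 : ∑ i, φ (e (σ (f i))) - (t : ℝ) • ∑ j, |v j| • φ (e (σ j)) =
      φ (signedSum (fun i => σ (f i)) - (t : ℝ) • v) := by
    have h2 : φ v = ∑ j, |v j| • φ (e (σ j)) := by
      conv_lhs => rw [← hcomb]
      simp only [map_sum, map_smul]
    rw [map_sub, map_smul, h2]
    simp only [signedSum, map_sum]
    rfl
  rw [h1, hφ, Matrix.mulVec_sub, Matrix.mulVec_smul, hv] at hf
  simpa using hf

/-! ### The null space property and exact recovery -/

/-- The null space property. If `‖M y‖₂² > p ‖y‖₂² / 4` for every nonzero sum `y` of `72 s` signed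
unit vectors, then no nonzero vector of the kernel of `M` has at least half of its `ℓ¹`-norm on a
set of at most `s` coordinates. -/
lemma sum_abs_lt_sum_abs_compl_of_mulVec_eq_zero {κ : Type*} [Fintype κ] [DecidableEq κ] {p s : ℕ}
    (hp : 0 < p) {M : Matrix (Fin p) κ ℝ} (hM : ∀ i j, M i j ^ 2 = 1)
    (hgood : ∀ f : Fin (72 * s) → κ × Bool, signedSum f ≠ 0 →
      p / 4 * ∑ j, signedSum f j ^ 2 < ∑ i, (M.mulVec (signedSum f)) i ^ 2)
    {v : κ → ℝ} (hv : M.mulVec v = 0) (hv0 : v ≠ 0) {T : Finset κ} (hT : T.card ≤ s) :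
    ∑ j ∈ T, |v j| < ∑ j ∈ Tᶜ, |v j| := by
  by_contra! hcon
  have hL : 0 < ∑ j, |v j| := by
    obtain ⟨j, hj⟩ := Function.ne_iff.1 hv0
    exact Finset.sum_pos' (fun i _ => abs_nonneg _) ⟨j, Finset.mem_univ j, abs_pos.2 hj⟩
  set L := ∑ j, |v j| with hLdef
  let u : κ → ℝ := L⁻¹ • v
  have hu1 : ∑ j, |u j| = 1 := by
    simp only [u, Pi.smul_apply, smul_eq_mul, abs_mul, abs_of_pos (inv_pos.2 hL)]
    rw [← Finset.mul_sum, ← hLdef, inv_mul_cancel₀ hL.ne']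
  have hu : M.mulVec u = 0 := by simp [u, Matrix.mulVec_smul, hv]
  have hsq : L ^ 2 ≤ 4 * s * ∑ j, v j ^ 2 := by
    have h1 : L ≤ 2 * ∑ j ∈ T, |v j| := by
      rw [hLdef, ← Finset.sum_add_sum_compl T]
      linarith
    have h2 : (∑ j ∈ T, |v j|) ^ 2 ≤ T.card * ∑ j ∈ T, |v j| ^ 2 := sq_sum_le_card_mul_sum_sq
    have h3 : ∑ j ∈ T, |v j| ^ 2 ≤ ∑ j, v j ^ 2 := by
      simp only [sq_abs]
      exact Finset.sum_le_sum_of_subset_of_nonneg (Finset.subset_univ T)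
        fun i _ _ => sq_nonneg _
    have h4 : (T.card : ℝ) * ∑ j ∈ T, |v j| ^ 2 ≤ s * ∑ j, v j ^ 2 := by
      gcongr
    nlinarith
  have hu2 : 1 ≤ 4 * s * ∑ j, u j ^ 2 := by
    have : ∑ j, u j ^ 2 = (L ^ 2)⁻¹ * ∑ j, v j ^ 2 := by
      simp [u, mul_pow, Finset.mul_sum]
    rw [this, mul_left_comm, ← div_eq_inv_mul, le_div_iff₀ (by positivity), one_mul]
    exact hsq
  have hs : 0 < s := by
    rcases Nat.eq_zero_or_pos s with rfl | h
    · norm_num at hu2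
    · exact h
  obtain ⟨f, hf⟩ := exists_signedSum_approx hp hM hu hu1 (72 * s)
  set t : ℝ := ((72 * s : ℕ) : ℝ) with ht
  have hts : t = 72 * s := by rw [ht]; push_cast; ring
  have hsR : (0 : ℝ) < s := by exact_mod_cast hs
  set y := signedSum f with hy
  have hpR : (0 : ℝ) < p := by exact_mod_cast hp
  have hB : 0 ≤ (p : ℝ)⁻¹ * ∑ i, (M.mulVec y) i ^ 2 := by positivity
  have hD : 0 ≤ ∑ j, (y j - t * u j) ^ 2 := by positivity
  have hlow : t ^ 2 * ∑ j, u j ^ 2 ≤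
      3 / 2 * ∑ j, y j ^ 2 + 3 * ∑ j, (y j - t * u j) ^ 2 := by
    rw [Finset.mul_sum, Finset.mul_sum, Finset.mul_sum, ← Finset.sum_add_distrib]
    refine Finset.sum_le_sum fun j _ => ?_
    nlinarith [sq_nonneg (3 * y j - 2 * (t * u j))]
  -- The choice `t = 72 s` makes `‖t u‖₂² ≥ 18 t`, which leaves `‖y‖₂² ≥ 8 t` after the error `2 t`.
  have ht2 : 18 * t ≤ t ^ 2 * ∑ j, u j ^ 2 := by
    have : t ^ 2 * ∑ j, u j ^ 2 = 18 * t * (4 * s * ∑ j, u j ^ 2) := by rw [hts]; ring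
    rw [this]
    exact le_mul_of_one_le_right (by rw [hts]; positivity) hu2
  have htpos : 0 < t := by rw [hts]; positivity
  have hy8 : 8 * t ≤ ∑ j, y j ^ 2 := by linarith
  have hy0 : y ≠ 0 := by
    intro h
    simp [h] at hy8
    linarith
  have hMy : ∑ i, (M.mulVec y) i ^ 2 ≤ p * (2 * t) := by
    have : (p : ℝ)⁻¹ * ∑ i, (M.mulVec y) i ^ 2 ≤ 2 * t := by linarith
    rwa [← div_eq_inv_mul, div_le_iff₀' hpR] at this
  have := hgood f hy0
  nlinarith

/-- A matrix with the null space property of order `s` recovers every `s`-sparse vector by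
`ℓ¹`-minimization. -/
lemma isUniqueL1Solution_of_nullSpaceProperty {ι κ : Type*} [Fintype κ] [DecidableEq κ] {s : ℕ}
    {M : Matrix ι κ ℝ}
    (hnsp : ∀ v : κ → ℝ, M.mulVec v = 0 → v ≠ 0 → ∀ T : Finset κ, T.card ≤ s →
      ∑ j ∈ T, |v j| < ∑ j ∈ Tᶜ, |v j|)
    {x : κ → ℝ} (hx : IsSparse s x) : IsUniqueL1Solution M (M.mulVec x) x := by
  classical
  refine ⟨rfl, fun u hu hne => ?_⟩
  let T : Finset κ := Finset.univ.filter fun j => x j ≠ 0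
  have hT : T.card ≤ s := by
    have : (T : Set κ) = Function.support x := by ext; simp [T]
    rwa [IsSparse, ← this, Set.ncard_coe_finset] at hx
  have h := hnsp (u - x) (by rw [Matrix.mulVec_sub, hu, sub_self]) (sub_ne_zero.2 hne) T hT
  have h0 : ∀ j ∈ Tᶜ, x j = 0 := by simp [T]
  have h1 : ∑ j ∈ T, |x j| ≤ ∑ j ∈ T, |u j| + ∑ j ∈ T, |(u - x) j| := by
    rw [← Finset.sum_add_distrib]
    refine Finset.sum_le_sum fun j _ => ?_
    have := abs_sub (u j) (u j - x j)
    rwa [sub_sub_cancel] at this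
  have h2 : ∑ j ∈ Tᶜ, |(u - x) j| = ∑ j ∈ Tᶜ, |u j| :=
    Finset.sum_congr rfl fun j hj => by rw [Pi.sub_apply, h0 j hj, sub_zero]
  have h3 : ∑ j ∈ Tᶜ, |x j| = 0 := Finset.sum_eq_zero fun j hj => by rw [h0 j hj, abs_zero]
  rw [← Finset.sum_add_sum_compl T, ← Finset.sum_add_sum_compl T fun j => |u j|, h3]
  linarith

/-! ### Small ball estimate for random signs -/

/-- If the variables `X (i, j)` are independent, so are the functions `g (X (i, ·))` of the rows:
the expectation of their product factorizes. -/
lemma integral_prod_rows {Ω ι κ : Type*} [MeasurableSpace Ω] {μ : Measure Ω}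
    [Fintype κ] [DecidableEq ι] [IsProbabilityMeasure μ] {X : ι × κ → Ω → ℝ}
    (hX : ∀ q, Measurable (X q)) (hind : iIndepFun X μ) {g : (κ → ℝ) → ℝ} (hg : Measurable g)
    (F : Finset ι) :
    ∫ ω, ∏ i ∈ F, g (fun j => X (i, j) ω) ∂μ = ∏ i ∈ F, ∫ ω, g (fun j => X (i, j) ω) ∂μ := by
  classical
  have hm : ∀ i, Measurable fun ω => g (fun j => X (i, j) ω) := fun i =>
    hg.comp (measurable_pi_lambda _ fun j => hX _)
  induction F using Finset.induction_on with
  | empty => simp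
  | insert a F ha ih =>
    have hdis : Disjoint (({a} : Finset ι) ×ˢ (Finset.univ : Finset κ)) (F ×ˢ Finset.univ) :=
      Finset.disjoint_product.2 (Or.inl (Finset.disjoint_singleton_left.2 ha))
    have h := hind.indepFun_finset _ _ hdis hX
    let φ : ((({a} : Finset ι) ×ˢ (Finset.univ : Finset κ) : Finset (ι × κ)) → ℝ) → ℝ :=
      fun u => g fun j => u ⟨(a, j), by simp⟩
    let ψ : ((F ×ˢ (Finset.univ : Finset κ) : Finset (ι × κ)) → ℝ) → ℝ :=
      fun u => ∏ i ∈ F.attach, g fun j => u ⟨(i.1, j), by simp⟩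
    have hφ : Measurable φ := hg.comp (measurable_pi_lambda _ fun j => measurable_pi_apply _)
    have hψ : Measurable ψ := Finset.measurable_fun_prod _ fun i _ =>
      hg.comp (measurable_pi_lambda _ fun j => measurable_pi_apply _)
    have h2 : IndepFun (fun ω => g (fun j => X (a, j) ω))
        (fun ω => ∏ i ∈ F, g (fun j => X (i, j) ω)) μ := by
      have h3 : (fun ω => ∏ i ∈ F, g (fun j => X (i, j) ω)) =
          ψ ∘ fun ω q => X q.1 ω := by
        ext ω
        exact (Finset.prod_attach F fun i => g (fun j => X (i, j) ω)).symm
      rw [h3]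
      exact h.comp hφ hψ
    simp_rw [Finset.prod_insert ha]
    rw [h2.integral_fun_mul_eq_mul_integral (hm a).aestronglyMeasurable
      (Finset.measurable_fun_prod _ fun i _ => hm i).aestronglyMeasurable, ih]

/-- An affine form in independent random signs has the second moment `c² + ∑ y_j²`, and its fourth
moment is at most three times the square of the second. -/
lemma moments_add_sum_mul_sign {Ω κ : Type*} [MeasurableSpace Ω] {μ : Measure Ω}
    [IsProbabilityMeasure μ] {ε : κ → Ω → ℝ} (hε : ∀ j, Measurable (ε j))
    (hind : iIndepFun ε μ) (hsq : ∀ j, ∀ᵐ ω ∂μ, ε j ω ^ 2 = 1) (hmean : ∀ j, ∫ ω, ε j ω ∂μ = 0)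
    (c : ℝ) (y : κ → ℝ) (F : Finset κ) :
    (∃ K, ∀ᵐ ω ∂μ, |c + ∑ j ∈ F, y j * ε j ω| ≤ K) ∧
    ∫ ω, (c + ∑ j ∈ F, y j * ε j ω) ^ 2 ∂μ = c ^ 2 + ∑ j ∈ F, y j ^ 2 ∧
    ∫ ω, (c + ∑ j ∈ F, y j * ε j ω) ^ 4 ∂μ ≤ 3 * (c ^ 2 + ∑ j ∈ F, y j ^ 2) ^ 2 := by
  classical
  induction F using Finset.induction_on with
  | empty =>
    refine ⟨⟨|c|, by simp⟩, by simp, ?_⟩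
    simp only [Finset.sum_empty, add_zero, integral_const, probReal_univ, one_smul]
    nlinarith [sq_nonneg (c ^ 2)]
  | insert a F ha ih =>
    obtain ⟨⟨K, hK⟩, h2, h4⟩ := ih
    have hsum : ∀ ω, c + ∑ j ∈ insert a F, y j * ε j ω =
        (c + ∑ j ∈ F, y j * ε j ω) + y a * ε a ω := by
      intro ω
      rw [Finset.sum_insert ha]
      ring
    simp_rw [hsum, Finset.sum_insert ha]
    set Z : Ω → ℝ := fun ω => c + ∑ j ∈ F, y j * ε j ω with hZ
    have hZm : Measurable Z := by fun_prop
    have hpow : ∀ n : ℕ, Integrable (fun ω => Z ω ^ n) μ := fun n =>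
      Integrable.of_bound (hZm.pow_const n).aestronglyMeasurable (K ^ n) (by
        filter_upwards [hK] with ω h
        rw [Real.norm_eq_abs, abs_pow]
        gcongr)
    have hZind : IndepFun Z (ε a) μ := by
      have h := hind.indepFun_finset F {a} (Finset.disjoint_singleton_right.2 ha) hε
      let φ : (F → ℝ) → ℝ := fun u => c + ∑ j ∈ F.attach, y j * u j
      let ψ : (({a} : Finset κ) → ℝ) → ℝ := fun u => u ⟨a, Finset.mem_singleton_self a⟩
      have hφ : Measurable φ := by fun_prop
      have hψ : Measurable ψ := measurable_pi_apply _
      have h3 : Z = φ ∘ fun ω q => ε q ω := by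
        ext ω
        exact congrArg (c + ·) (Finset.sum_attach F fun j => y j * ε j ω).symm
      rw [h3]
      exact h.comp hφ hψ
    -- Terms of odd degree in the new sign have mean zero; even powers of the sign are `1`.
    have hodd : ∀ n : ℕ, ∫ ω, Z ω ^ n * ε a ω ∂μ = 0 := by
      intro n
      have h := hZind.comp (φ := fun x => x ^ n) (ψ := id) (by fun_prop) measurable_id
      have := h.integral_fun_mul_eq_mul_integral (hZm.pow_const n).aestronglyMeasurable
        (hε a).aestronglyMeasurable
      simp only [Function.comp, id] at this
      rw [this, hmean, mul_zero]
    have hεabs : ∀ᵐ ω ∂μ, |ε a ω| = 1 := by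
      filter_upwards [hsq a] with ω h
      exact (abs_eq zero_le_one).2 (sq_eq_one_iff.1 h)
    have hoddi : ∀ n : ℕ, Integrable (fun ω => Z ω ^ n * ε a ω) μ := fun n =>
      Integrable.of_bound ((hZm.pow_const n).mul (hε a)).aestronglyMeasurable (K ^ n) (by
        filter_upwards [hK, hεabs] with ω h h1
        rw [Real.norm_eq_abs, abs_mul, abs_pow, h1, mul_one]
        gcongr)
    have e2 : ∫ ω, (Z ω + y a * ε a ω) ^ 2 ∂μ =
        ∫ ω, (Z ω ^ 2 + 2 * y a * (Z ω ^ 1 * ε a ω) + y a ^ 2) ∂μ := by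
      refine integral_congr_ae ?_
      filter_upwards [hsq a] with ω h
      linear_combination (y a) ^ 2 * h
    have e4 : ∫ ω, (Z ω + y a * ε a ω) ^ 4 ∂μ =
        ∫ ω, (Z ω ^ 4 + 4 * y a * (Z ω ^ 3 * ε a ω) + 6 * y a ^ 2 * Z ω ^ 2
          + 4 * y a ^ 3 * (Z ω ^ 1 * ε a ω) + y a ^ 4) ∂μ := by
      refine integral_congr_ae ?_
      filter_upwards [hsq a] with ω h
      linear_combination (6 * y a ^ 2 * Z ω ^ 2 + 4 * y a ^ 3 * Z ω * ε a ω
        + y a ^ 4 * (ε a ω ^ 2 + 1)) * h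
    refine ⟨⟨K + |y a|, ?_⟩, ?_, ?_⟩
    · filter_upwards [hK, hεabs] with ω h h1
      refine (abs_add_le _ _).trans ?_
      rw [abs_mul, h1, mul_one]
      exact add_le_add_left h _
    · rw [e2, integral_add (by fun_prop) (by fun_prop), integral_add (by fun_prop) (by fun_prop),
        integral_const_mul, hodd, h2]
      simp
      ring
    · rw [e4, integral_add (by fun_prop) (by fun_prop), integral_add (by fun_prop) (by fun_prop),
        integral_add (by fun_prop) (by fun_prop), integral_add (by fun_prop) (by fun_prop),
        integral_const_mul, integral_const_mul, integral_const_mul, hodd, hodd, h2]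
      simp only [mul_zero, add_zero, integral_const, probReal_univ, one_smul]
      nlinarith [sq_nonneg (y a ^ 2)]

/-- The second order upper bound for `exp (-x)` on the nonnegative half-line. -/
lemma exp_neg_le_one_sub_add_sq {x : ℝ} (hx : 0 ≤ x) : Real.exp (-x) ≤ 1 - x + x ^ 2 / 2 := by
  rw [Real.exp_neg, inv_le_iff_one_le_mul₀ (Real.exp_pos x)]
  have h := Real.quadratic_le_exp_of_nonneg hx
  have h0 : 0 ≤ 1 - x + x ^ 2 / 2 := by nlinarith [sq_nonneg (x - 1)]
  nlinarith [mul_le_mul_of_nonneg_left h h0, sq_nonneg (x ^ 2)]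

/-- The sum of the squares of independent copies of an affine form in random signs, one for each
element of `ι`, exceeds a quarter of its mean, up to an exponentially small probability. -/
lemma measureReal_sum_sq_le {Ω ι κ : Type*} [MeasurableSpace Ω] {μ : Measure Ω}
    [Fintype ι] [Fintype κ] [IsProbabilityMeasure μ] {ε : ι × κ → Ω → ℝ}
    (hε : ∀ q, Measurable (ε q)) (hind : iIndepFun ε μ) (hsq : ∀ q, ∀ᵐ ω ∂μ, ε q ω ^ 2 = 1)
    (hmean : ∀ q, ∫ ω, ε q ω ∂μ = 0) (c : ℝ) (y : κ → ℝ) (hpos : 0 < c ^ 2 + ∑ j, y j ^ 2) :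
    μ.real {ω | ∑ i, (c + ∑ j, y j * ε (i, j) ω) ^ 2 ≤
      Fintype.card ι / 4 * (c ^ 2 + ∑ j, y j ^ 2)} ≤ Real.exp (-(Fintype.card ι / 12)) := by
  classical
  set σ := c ^ 2 + ∑ j, y j ^ 2 with hσ
  -- The Laplace transform at `(3 σ)⁻¹`, which minimizes the second order bound.
  set l : ℝ := (3 * σ)⁻¹ with hl
  have hl0 : 0 < l := by positivity
  have hlσ : l * σ = 1 / 3 := by rw [hl]; field_simp
  let g : (κ → ℝ) → ℝ := fun u => Real.exp (-(l * (c + ∑ j, y j * u j) ^ 2))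
  have hg : Measurable g := by fun_prop
  have hrow : ∀ i, ∫ ω, g (fun j => ε (i, j) ω) ∂μ ≤ Real.exp (-(1 / 6)) := by
    intro i
    obtain ⟨⟨K, hK⟩, h2, h4⟩ := moments_add_sum_mul_sign (fun j => hε (i, j))
      (hind.precomp (g := fun j => (i, j)) (Prod.mk_right_injective i)) (fun j => hsq (i, j))
      (fun j => hmean (i, j)) c y Finset.univ
    set Z : Ω → ℝ := fun ω => c + ∑ j, y j * ε (i, j) ω with hZ
    have hZm : Measurable Z := by fun_prop
    have hpow : ∀ n : ℕ, Integrable (fun ω => Z ω ^ n) μ := fun n =>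
      Integrable.of_bound (hZm.pow_const n).aestronglyMeasurable (K ^ n) (by
        filter_upwards [hK] with ω h
        rw [Real.norm_eq_abs, abs_pow]
        gcongr)
    calc ∫ ω, g (fun j => ε (i, j) ω) ∂μ
        ≤ ∫ ω, (1 - l * Z ω ^ 2 + l ^ 2 / 2 * Z ω ^ 4) ∂μ := by
          refine integral_mono_of_nonneg (ae_of_all _ fun ω => (Real.exp_pos _).le)
            (by fun_prop) (ae_of_all _ fun ω => ?_)
          have := exp_neg_le_one_sub_add_sq (x := l * Z ω ^ 2) (by positivity)
          refine this.trans (le_of_eq ?_)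
          ring
      _ = 1 - l * σ + l ^ 2 / 2 * ∫ ω, Z ω ^ 4 ∂μ := by
          rw [integral_add (by fun_prop) (by fun_prop), integral_sub (by fun_prop) (by fun_prop),
            integral_const_mul, integral_const_mul, h2, ← hσ]
          simp
      _ ≤ 1 - l * σ + l ^ 2 / 2 * (3 * σ ^ 2) := by gcongr
      _ = 1 - 1 / 6 := by
          rw [show l ^ 2 / 2 * (3 * σ ^ 2) = 3 / 2 * (l * σ) ^ 2 by ring, hlσ]
          norm_num
      _ ≤ Real.exp (-(1 / 6)) := Real.one_sub_le_exp_neg _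
  set Q : Ω → ℝ := fun ω => ∑ i, (c + ∑ j, y j * ε (i, j) ω) ^ 2 with hQ
  have hQm : Measurable Q := by fun_prop
  have hint : Integrable (fun ω => Real.exp (-l * Q ω)) μ :=
    Integrable.of_bound (by fun_prop) 1 (ae_of_all _ fun ω => by
      rw [Real.norm_eq_abs, Real.abs_exp, Real.exp_le_one_iff, neg_mul, neg_nonpos]
      exact mul_nonneg hl0.le (Finset.sum_nonneg fun i _ => sq_nonneg _))
  refine (measure_le_le_exp_mul_mgf _ (neg_nonpos.2 hl0.le) hint).trans ?_
  have hmgf : mgf Q μ (-l) ≤ Real.exp (-(1 / 6)) ^ Fintype.card ι := by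
    have h1 : mgf Q μ (-l) = ∏ i, ∫ ω, g (fun j => ε (i, j) ω) ∂μ := by
      rw [← integral_prod_rows hε hind hg, mgf]
      refine integral_congr_ae (ae_of_all _ fun ω => ?_)
      simp only [hQ, g]
      rw [← Real.exp_sum, Finset.mul_sum]
      simp
    rw [h1, ← Finset.card_univ, ← Finset.prod_const]
    exact Finset.prod_le_prod (fun i _ => integral_nonneg fun ω => (Real.exp_pos _).le)
      fun i _ => hrow i
  refine (mul_le_mul_of_nonneg_left hmgf (Real.exp_pos _).le).trans (le_of_eq ?_)
  rw [← Real.exp_nat_mul, ← Real.exp_add]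
  congr 1
  linear_combination (Fintype.card ι / 4 : ℝ) * hlσ

/-! ### The program matrix -/

lemma programMatrix_apply_inl {p : ℕ} {S : Type*} (A : Matrix (Fin (p + 1)) S ℝ) (i : Fin p)
    (j : S) : programMatrix A i (Sum.inl j) = 2 * A i.castSucc j - 1 := by
  simp [programMatrix, augMatrix]

lemma programMatrix_apply_inr {p : ℕ} {S : Type*} (A : Matrix (Fin (p + 1)) S ℝ) (i : Fin p)
    (j : Unit) : programMatrix A i (Sum.inr j) = -1 := by
  simp [programMatrix, augMatrix]
  norm_num

lemma programMatrix_mulVec {p : ℕ} {S : Type*} [Fintype S] (A : Matrix (Fin (p + 1)) S ℝ)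
    (y : S ⊕ Unit → ℝ) (i : Fin p) :
    (programMatrix A).mulVec y i =
      -y (Sum.inr ()) + ∑ j, y (Sum.inl j) * (2 * A i.castSucc j - 1) := by
  simp only [Matrix.mulVec, dotProduct, Fintype.sum_sum_type, programMatrix_apply_inl,
    programMatrix_apply_inr, Finset.univ_unique, Finset.sum_singleton]
  rw [add_comm]
  congr 1
  · simp
  · exact Finset.sum_congr rfl fun j _ => mul_comm _ _

/-- When the last row of `A` is all ones, the data of the program are the exact image of the
augmented vector, whatever the signal on the hub. -/
lemma programData_eq_mulVec {p : ℕ} {S H : Type*} [Fintype S] [Fintype H]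
    {A : Matrix (Fin (p + 1)) S ℝ} (hA : ∀ j, A (Fin.last p) j = 1) (xS : S → ℝ) (xH : H → ℝ)
    (e₀ : ℝ) :
    programData (correctedData (measurements A xS xH e₀)) =
      (programMatrix A).mulVec (augVector xS e₀) := by
  have hy : ∀ i, correctedData (measurements A xS xH e₀) i = ∑ j, A i j * xS j - e₀ := by
    intro i
    simp [correctedData, measurements, hubMatrix, Matrix.mulVec, dotProduct]
    ring
  ext i
  rw [programMatrix_mulVec, programData, hy, hy]
  simp only [augVector, Sum.elim_inl, Sum.elim_inr, hA, mul_sub, mul_one, one_mul,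
    Finset.sum_sub_distrib, Finset.mul_sum]
  rw [Finset.sum_congr rfl fun j _ => show xS j * (2 * A i.castSucc j) =
    2 * (A i.castSucc j * xS j) by ring]
  ring

section Random

variable {Ω S : Type*} [MeasurableSpace Ω] {μ : Measure Ω} [IsProbabilityMeasure μ] {p : ℕ}
  {A : Ω → Matrix (Fin (p + 1)) S ℝ}

lemma IsRandomConstruction.ae_eq_one_or_eq_zero (h : IsRandomConstruction μ A) (i : Fin p)
    (j : S) : ∀ᵐ ω ∂μ, A ω i.castSucc j = 1 ∨ A ω i.castSucc j = 0 := by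
  have hm := h.measurable_entry i.castSucc j
  have h1 : MeasurableSet {ω | A ω i.castSucc j = 1} := hm (measurableSet_singleton 1)
  have h0 : MeasurableSet {ω | A ω i.castSucc j = 0} := hm (measurableSet_singleton 0)
  have hd : Disjoint {ω | A ω i.castSucc j = 1} {ω | A ω i.castSucc j = 0} := by
    rw [Set.disjoint_left]
    intro ω (h : _ = _) (h' : _ = _)
    rw [h] at h'
    exact one_ne_zero h'
  have := measure_union (μ := μ) hd h0
  rw [h.prob_one, h.prob_zero, ENNReal.add_halves] at this
  exact (mem_ae_iff_prob_eq_one (h1.union h0)).2 this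

lemma IsRandomConstruction.integral_sign (h : IsRandomConstruction μ A) (i : Fin p) (j : S) :
    ∫ ω, (2 * A ω i.castSucc j - 1) ∂μ = 0 := by
  have h1 : MeasurableSet {ω | A ω i.castSucc j = 1} :=
    h.measurable_entry i.castSucc j (measurableSet_singleton 1)
  have e : ∫ ω, (2 * A ω i.castSucc j - 1) ∂μ =
      ∫ ω, (2 * Set.indicator {ω | A ω i.castSucc j = 1} 1 ω - 1) ∂μ := by
    refine integral_congr_ae ?_
    filter_upwards [h.ae_eq_one_or_eq_zero i j] with ω hω
    rcases hω with hω | hω <;> simp [Set.indicator, hω]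
  have hi : Integrable (Set.indicator {ω | A ω i.castSucc j = 1} (1 : Ω → ℝ)) μ :=
    (integrable_const (1 : ℝ)).indicator h1
  rw [e, integral_sub (hi.const_mul 2) (integrable_const _), integral_const_mul,
    integral_indicator_one h1, Measure.real, h.prob_one]
  simp

/-- For a fixed nonzero vector, the random program matrix shrinks its squared norm below a quarter
of its mean with exponentially small probability only. -/
lemma IsRandomConstruction.measureReal_mulVec_small_le [Fintype S] (h : IsRandomConstruction μ A)
    {y : S ⊕ Unit → ℝ} (hy : y ≠ 0) :
    μ.real {ω | ∑ i, ((programMatrix (A ω)).mulVec y i) ^ 2 ≤ p / 4 * ∑ j, y j ^ 2} ≤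
      Real.exp (-(p / 12)) := by
  have hsum : ∑ j, y j ^ 2 = (-y (Sum.inr ())) ^ 2 + ∑ j, y (Sum.inl j) ^ 2 := by
    rw [Fintype.sum_sum_type]
    simp [add_comm]
  have hpos : 0 < ∑ j, y j ^ 2 := by
    obtain ⟨j, hj⟩ := Function.ne_iff.1 hy
    exact Finset.sum_pos' (fun i _ => sq_nonneg _) ⟨j, Finset.mem_univ j, sq_pos_of_ne_zero hj⟩
  rw [hsum] at hpos ⊢
  simp_rw [programMatrix_mulVec]
  have hmeas : ∀ q : Fin p × S, Measurable fun ω => 2 * A ω q.1.castSucc q.2 - 1 := fun q =>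
    ((h.measurable_entry _ _).const_mul 2).sub_const 1
  have hind : iIndepFun (fun (q : Fin p × S) ω => 2 * A ω q.1.castSucc q.2 - 1) μ :=
    h.indep.comp (fun _ x => 2 * x - 1) fun _ => by fun_prop
  have := measureReal_sum_sq_le hmeas hind (fun q => by
      filter_upwards [h.ae_eq_one_or_eq_zero q.1 q.2] with ω hω
      rcases hω with hω | hω <;> rw [hω] <;> norm_num)
    (fun q => h.integral_sign q.1 q.2) (-y (Sum.inr ())) (fun j => y (Sum.inl j)) hpos
  simpa only [Fintype.card_fin] using this

end Random

/-! ### The union bound -/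

/-- The number of sequences of `72 s` signed unit vectors in dimension `n + 1`, times the failure
probability for one of them, is at most `1 / n` once the number of rows is of order `s log n`. -/
lemma card_pow_mul_exp_le {n s p : ℕ} (hn : 3 ≤ n) (hs : 0 < s)
    (hp : 1741 * (s : ℝ) * Real.log n ≤ ((p + 1 : ℕ) : ℝ)) :
    0 < p ∧ ((((n + 1) * 2) ^ (72 * s) : ℕ) : ℝ) * Real.exp (-(p / 12)) ≤ (n : ℝ)⁻¹ := by
  have hnR : (3 : ℝ) ≤ n := by exact_mod_cast hn
  have hL : 1 ≤ Real.log n := by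
    rw [Real.le_log_iff_exp_le (by linarith)]
    linarith [Real.exp_one_lt_d9]
  have hsR : (1 : ℝ) ≤ s := by exact_mod_cast hs
  set L := Real.log n with hLd
  have hnL : (n : ℝ) = Real.exp L := (Real.exp_log (by linarith)).symm
  have hsL : L ≤ s * L := le_mul_of_one_le_left (by linarith) hsR
  push_cast at hp
  have hp' : 1740 * (s * L) ≤ p := by linarith
  refine ⟨by
    have : (0 : ℝ) < p := by linarith
    exact_mod_cast this, ?_⟩
  have h1 : (((n + 1) * 2 : ℕ) : ℝ) ≤ Real.exp (2 * L) := by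
    rw [show 2 * L = L + L by ring, Real.exp_add, ← hnL]
    push_cast
    nlinarith
  calc ((((n + 1) * 2) ^ (72 * s) : ℕ) : ℝ) * Real.exp (-(p / 12))
      ≤ Real.exp (2 * L) ^ (72 * s) * Real.exp (-(p / 12)) := by
        rw [Nat.cast_pow]
        gcongr
    _ = Real.exp (144 * (s * L) - p / 12) := by
        rw [← Real.exp_nat_mul, ← Real.exp_add]
        congr 1
        push_cast
        ring
    _ ≤ Real.exp (-L) := by
        rw [Real.exp_le_exp]
        linarith
    _ = (n : ℝ)⁻¹ := by rw [Real.exp_neg, ← hnL]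

/-- The union bound for uniform recovery: if there is at least one random row, the failure
probability is at most the number of sequences of `72 s` signed unit vectors times the failure
probability for one of them. -/
lemma IsRandomConstruction.one_sub_le_measureReal_recovery {Ω S : Type*} (H : Type*) [Fintype S]
    [Fintype H] [MeasurableSpace Ω] {μ : Measure Ω} [IsProbabilityMeasure μ] {p : ℕ} (hp : 0 < p)
    {A : Ω → Matrix (Fin (p + 1)) S ℝ} (h : IsRandomConstruction μ A) (s : ℕ) :
    1 - ((((Fintype.card S + 1) * 2) ^ (72 * s) : ℕ) : ℝ) * Real.exp (-(p / 12)) ≤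
      μ.real {ω | ∀ (xS : S → ℝ) (e₀ : ℝ), IsSparse s (augVector xS e₀) → ∀ xH : H → ℝ,
        IsUniqueL1Solution (programMatrix (A ω))
          (programData (correctedData (measurements (A ω) xS xH e₀))) (augVector xS e₀)} := by
  classical
  set G := {ω | ∀ (xS : S → ℝ) (e₀ : ℝ), IsSparse s (augVector xS e₀) → ∀ xH : H → ℝ,
    IsUniqueL1Solution (programMatrix (A ω))
      (programData (correctedData (measurements (A ω) xS xH e₀))) (augVector xS e₀)}
  let B : (Fin (72 * s) → (S ⊕ Unit) × Bool) → Set Ω := fun f =>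
    {ω | ∑ i, ((programMatrix (A ω)).mulVec (signedSum f) i) ^ 2 ≤
      p / 4 * ∑ j, signedSum f j ^ 2}
  let F : Finset (Fin (72 * s) → (S ⊕ Unit) × Bool) := Finset.univ.filter fun f => signedSum f ≠ 0
  have hB : μ.real (⋃ f ∈ F, B f) ≤
      ((((Fintype.card S + 1) * 2) ^ (72 * s) : ℕ) : ℝ) * Real.exp (-(p / 12)) := by
    calc μ.real (⋃ f ∈ F, B f) ≤ ∑ f ∈ F, μ.real (B f) := measureReal_biUnion_finset_le F B
      _ ≤ ∑ f ∈ F, Real.exp (-(p / 12)) := Finset.sum_le_sum fun f hf =>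
          h.measureReal_mulVec_small_le (Finset.mem_filter.1 hf).2
      _ = F.card * Real.exp (-(p / 12)) := by rw [Finset.sum_const, nsmul_eq_mul]
      _ ≤ _ := by
          have hF : F.card ≤ ((Fintype.card S + 1) * 2) ^ (72 * s) := by
            refine (Finset.card_le_univ F).trans (le_of_eq ?_)
            simp
          gcongr
  -- The recovery event need not be measurable, so it is bounded through a covering of almost all of
  -- `Ω` instead of its complement.
  have hcov : ∀ᵐ ω ∂μ, ω ∈ (⋃ f ∈ F, B f) ∪ G := by
    filter_upwards [ae_all_iff.2 fun i => ae_all_iff.2 fun j => h.ae_eq_one_or_eq_zero i j]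
      with ω hω
    by_cases hb : ω ∈ ⋃ f ∈ F, B f
    · exact Or.inl hb
    · right
      intro xS e₀ hx xH
      rw [programData_eq_mulVec (h.last_row ω)]
      refine isUniqueL1Solution_of_nullSpaceProperty (fun v hv hv0 T hT =>
        sum_abs_lt_sum_abs_compl_of_mulVec_eq_zero hp ?_ (fun f hf => ?_) hv hv0 hT) hx
      · rintro i (j | j)
        · rw [programMatrix_apply_inl]
          rcases hω i j with h | h <;> rw [h] <;> norm_num
        · rw [programMatrix_apply_inr]
          norm_num
      · by_contra! hcon
        exact hb (Set.mem_biUnion (Finset.mem_filter.2 ⟨Finset.mem_univ f, hf⟩) hcon)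
  have h1 : 1 ≤ μ.real (⋃ f ∈ F, B f) + μ.real G := by
    refine le_trans ?_ (measureReal_union_le _ _)
    have : μ ((⋃ f ∈ F, B f) ∪ G) = 1 :=
      (measure_congr (Filter.eventuallyEq_univ.2 hcov)).trans measure_univ
    rw [Measure.real, this, ENNReal.toReal_one]
  linarith

end HubRecovery

theorem mainTheorem9 :
    ∃ C : ℝ, 0 < C ∧ ∃ α : ℝ, 0 < α ∧ ∃ K : ℝ, 0 < K ∧ ∃ n₀ : ℕ,
      ∀ (S H : Type*) [Fintype S] [Fintype H], n₀ ≤ Fintype.card S →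
      ∀ k p : ℕ, C * ((k : ℝ) + 1) * Real.log (Fintype.card S) ≤ ((p + 1 : ℕ) : ℝ) →
      ∀ (Ω : Type*) [MeasurableSpace Ω] (μ : Measure Ω) [IsProbabilityMeasure μ]
        (A : Ω → Matrix (Fin (p + 1)) S ℝ), HubRecovery.IsRandomConstruction μ A →
        1 - K * (Fintype.card S : ℝ) ^ (-α) ≤
          μ.real {ω | ∀ (xS : S → ℝ) (e₀ : ℝ),
            HubRecovery.IsSparse (k + 1) (HubRecovery.augVector xS e₀) →
            ∀ xH : H → ℝ,
              HubRecovery.IsUniqueL1Solution (HubRecovery.programMatrix (A ω))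
                (HubRecovery.programData (HubRecovery.correctedData
                  (HubRecovery.measurements (A ω) xS xH e₀)))
                (HubRecovery.augVector xS e₀)} := by
  refine ⟨1741, by norm_num, 1, one_pos, 1, one_pos, 3, ?_⟩
  intro S H _ _ hS k p hp Ω _ μ _ A hA
  obtain ⟨hp0, hbound⟩ := HubRecovery.card_pow_mul_exp_le (s := k + 1) (p := p) hS k.succ_pos
    (by exact_mod_cast hp)
  have := hA.one_sub_le_measureReal_recovery H hp0 (k + 1)
  rw [one_mul, Real.rpow_neg_one]
  linarith
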